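/- A predicate is a function $P:\{0,1\}^2\to\{0,1\}$. A weighted digraph $G=(V,E,w)$ consists of a finite vertex set $V$, a set $E\subseteq V\times V$ of directed edges (loops allowed) and a weight function $w:E\to\mathbb{R}_{\ge 0}$. For $S\subseteq V$ with indicator function $\mathbf 1_S$, put $$P_G(S)=\sum_{(v,u)\in E}P(\mathbf 1_S(v),\mathbf 1_S(u))\,w(v,u).$$ A re-weighted sub-digraph of $G$ is a weighted digraph $G_\epsilon=(V,E_\epsilon,w_\epsilon)$ with $E_\epsilon\subseteq E$ and an arbitrary weight function $w_\epsilon:E_\epsilon\to\mathbb{R}_{\ge 0}$. It is an $\epsilon$-$P$-sparsifier of $G$ if $$(1-\epsilon)\,P_G(S)\le P_{G_\epsilon}(S)\le(1+\epsilon)\,P_G(S)\qquad\text{for every } S\subseteq V.$$ Consider the following twelve predicates of $(x,y)\in\{0,1\}^2$: $\mathrm{Cut}$ ($x\neq y$), $\mathrm{unCut}$ ($x=y$), $\mathrm{Or}$ ($x=1$ or $y=1$), $\mathrm{nAnd}$ (not $x=y=1$), $\overline{10}$ ($(x,y)\neq(1,0)$), $\overline{01}$ ($(x,y)\neq(0,1)$),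 $x0$ ($y=0$), $x1$ ($y=1$), $0x$ ($x=0$), $1x$ ($x=1$), $\vec 1$ (always satisfied) and $\vec 0$ (never satisfied). **Theorem.** There is an absolute constant $C>0$ such that for every weighted digraph $G=(V,E,w)$ and every $\epsilon\in(0,1)$ there is a re-weighted sub-digraph $G_\epsilon$ of $G$ with at most $C\,|V|/\epsilon^2$ edges which is simultaneously an $\epsilon$-$P$-sparsifier of $G$ for every $P\in\{\mathrm{Cut},\mathrm{unCut},\mathrm{Or},\mathrm{nAnd},\overline{10},\overline{01},x0,x1,0x,1x,\vec 1,\vec 0\}$. -/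

import Mathlib

/-- A two-variable Boolean predicate `P : {0,1}² → {0,1}` (`true` is `1`, `false` is `0`). -/
abbrev BoolPred : Type := Bool → Bool → Bool

namespace BoolPred

/-- `Cut`: the two values differ. -/
def Cut : BoolPred := fun x y => xor x y

/-- `unCut`: the two values agree. -/
def unCut : BoolPred := fun x y => !(xor x y)

/-- `Or`: at least one value is `1`. -/
def Or : BoolPred := fun x y => x || y

/-- `nAnd`: not both values are `1`. -/
def nAnd : BoolPred := fun x y => !(x && y)

/-- Satisfied by every input except `(1, 0)`. -/
def not10 : BoolPred := fun x y => !(x && !y)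

/-- Satisfied by every input except `(0, 1)`. -/
def not01 : BoolPred := fun x y => !(!x && y)

/-- `x0`: the second value is `0`. -/
def x0 : BoolPred := fun _ y => !y

/-- `x1`: the second value is `1`. -/
def x1 : BoolPred := fun _ y => y

/-- `0x`: the first value is `0`. -/
def zerox : BoolPred := fun x _ => !x

/-- `1x`: the first value is `1`. -/
def onex : BoolPred := fun x _ => x

/-- The predicate that is always satisfied. -/
def allOne : BoolPred := fun _ _ => true

/-- The predicate that is never satisfied. -/
def allZero : BoolPred := fun _ _ => false

end BoolPred

/-- A digraph on the vertex set `V` with nonnegative edge weights. The edges are ordered pairs of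
vertices; loops are allowed. Values of `weight` outside `edges` carry no information. -/
structure WeightedDigraph (V : Type*) where
  edges : Finset (V × V)
  weight : V × V → ℝ
  weight_nonneg : ∀ e ∈ edges, 0 ≤ weight e

namespace WeightedDigraph

variable {V : Type*}

open Classical in
/-- The indicator function of `S`, with values in `{0,1}`. -/
noncomputable def indic (S : Set V) (v : V) : Bool := decide (v ∈ S)

/-- `P_G(S) = ∑_{(v,u) ∈ E} P(1_S(v), 1_S(u)) · w(v,u)`. -/
noncomputable def predValue (G : WeightedDigraph V) (P : BoolPred) (S : Set V) : ℝ :=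
  ∑ e ∈ G.edges, ((P (indic S e.1) (indic S e.2)).toNat : ℝ) * G.weight e

/-- `H` is a re-weighted sub-digraph of `G` (on the same vertex set). -/
def IsSubdigraph (H G : WeightedDigraph V) : Prop := H.edges ⊆ G.edges

/-- `H` is an `ε`-`P`-sparsifier of `G`: a re-weighted sub-digraph of `G` with
`P_H(S) ∈ (1 ± ε) · P_G(S)` for every set `S` of vertices. -/
def IsSparsifier (ε : ℝ) (P : BoolPred) (H G : WeightedDigraph V) : Prop :=
  H.IsSubdigraph G ∧
    ∀ S : Set V, (1 - ε) * G.predValue P S ≤ H.predValue P S ∧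
      H.predValue P S ≤ (1 + ε) * G.predValue P S

end WeightedDigraph

/-! Eight of the predicates, constants included, have the form `(a x - b y) ^ 2`, so `predValue` on
them is a value of the single quadratic form `∑ w(v,u) (x_v - y_u) ^ 2` in independent potentials on
tails and heads, the form of the bipartite double cover. The other four are half-sums of three of
these eight, and sparsifier bounds are linear in the predicate (`IsSparsifier.half_sum`). One
spectral sparsifier of the form thus serves all twelve.

Its linear size comes from the Batson–Spielman–Srivastava barrier method. For vectors with `∑ v vᵀ =
1`, a weighted sum of the `v vᵀ` is built one term at a time between two moving barriers, and the
traces of the inverse distances to the barriers never grow. Averaging over the vectors shows that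
some vector and weight always keep both traces bounded (`exists_barrier_step`).
`exists_sum_sq_sparsifier` reduces arbitrary sums of squares to this isotropic case. -/

open Matrix

/-! ### Resolvent traces under rank-one updates -/

namespace Matrix

variable {n : Type*} [Fintype n] [DecidableEq n]

/-- The spectral data of a positive definite real matrix, packaged as formulas for the traces of its
resolvents. -/
theorem PosDef.exists_spectrum {M : Matrix n n ℝ} (hM : M.PosDef) :
    ∃ μ : n → ℝ, (∀ j, 0 < μ j) ∧
      ∀ c : ℝ, (∀ j, 0 < μ j + c) → (M + c • 1).PosDef ∧
        trace (M + c • 1)⁻¹ = ∑ j, (μ j + c)⁻¹ ∧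
        trace ((M + c • 1)⁻¹ * (M + c • 1)⁻¹) = ∑ j, (μ j + c)⁻¹ ^ 2 := by
  set Q : Matrix n n ℝ := (hM.1.eigenvectorUnitary : Matrix n n ℝ) with hQ
  set μ := hM.1.eigenvalues with hμ
  have hQ1 : Q * star Q = 1 := Unitary.coe_mul_star_self _
  have hQ2 : star Q * Q = 1 := Unitary.coe_star_mul_self _
  have hspec : M = Q * diagonal μ * star Q := by
    have := hM.1.spectral_theorem
    rw [Unitary.conjStarAlgAut_apply] at this
    simpa [Function.comp_def] using this
  have hconj (a b : n → ℝ) : (Q * diagonal a * star Q) * (Q * diagonal b * star Q) =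
      Q * diagonal (fun j => a j * b j) * star Q := by
    rw [← diagonal_mul_diagonal]
    calc _ = Q * diagonal a * (star Q * Q) * diagonal b * star Q := by simp only [Matrix.mul_assoc]
      _ = _ := by rw [hQ2]; simp only [Matrix.mul_assoc, Matrix.mul_one]
  have htr (a : n → ℝ) : trace (Q * diagonal a * star Q) = ∑ j, a j := by
    rw [trace_mul_cycle, hQ2, Matrix.one_mul, trace_diagonal]
  refine ⟨μ, hM.eigenvalues_pos, fun c hc => ?_⟩
  have hshift : M + c • 1 = Q * diagonal (fun j => μ j + c) * star Q := by
    have : diagonal (fun j => μ j + c) = diagonal μ + c • (1 : Matrix n n ℝ) := by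
      ext i j; by_cases h : i = j <;> simp [h]
    rw [this, Matrix.mul_add, Matrix.add_mul, ← hspec, Matrix.mul_smul, Matrix.mul_one,
      Matrix.smul_mul, hQ1]
  have hinv : (M + c • 1)⁻¹ = Q * diagonal (fun j => (μ j + c)⁻¹) * star Q := by
    apply inv_eq_right_inv
    rw [hshift, hconj]
    simp only [mul_inv_cancel₀ (hc _).ne']
    rw [diagonal_one, Matrix.mul_one, hQ1]
  refine ⟨?_, by rw [hinv, htr], by rw [hinv, hconj, htr]; simp only [sq]⟩
  rw [hshift]
  refine (PosDef.diagonal hc).mul_mul_conjTranspose_same ?_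
  intro x y hxy
  have := congrArg (fun z => z ᵥ* star Q) hxy
  simpa [vecMul_vecMul, hQ1] using this

theorem PosDef.inv_vecMul_eq {X : Matrix n n ℝ} (hX : X.PosDef) (v : n → ℝ) :
    v ᵥ* X⁻¹ = X⁻¹ *ᵥ v := by
  have h : (X⁻¹)ᵀ = X⁻¹ := by simpa using hX.inv.1.eq
  rw [← mulVec_transpose, h]

/-- The trace form of the Sherman–Morrison formula. -/
theorem PosDef.trace_inv_add_smul_vecMulVec {X : Matrix n n ℝ} (hX : X.PosDef) (v : n → ℝ) (s : ℝ)
    (hs : 1 + s * (v ⬝ᵥ X⁻¹ *ᵥ v) ≠ 0) :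
    trace (X + s • vecMulVec v v)⁻¹ =
      trace X⁻¹ - s / (1 + s * (v ⬝ᵥ X⁻¹ *ᵥ v)) * (v ⬝ᵥ (X⁻¹ * X⁻¹) *ᵥ v) := by
  have hu : IsUnit X.det := (isUnit_iff_isUnit_det X).1 hX.isUnit
  set c := v ⬝ᵥ X⁻¹ *ᵥ v with hc
  have h1 : (X + s • vecMulVec v v) *
      (X⁻¹ - (s / (1 + s * c)) • vecMulVec (X⁻¹ *ᵥ v) (X⁻¹ *ᵥ v)) = 1 := by
    rw [Matrix.mul_sub, Matrix.add_mul, Matrix.mul_nonsing_inv _ hu, Matrix.smul_mul,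
      vecMulVec_mul, hX.inv_vecMul_eq, Matrix.mul_smul, Matrix.add_mul, mul_vecMulVec,
      mulVec_mulVec, Matrix.mul_nonsing_inv _ hu, one_mulVec, Matrix.smul_mul,
      vecMulVec_mul_vecMulVec, ← hc]
    ext i j
    simp only [sub_apply, add_apply, smul_apply, vecMulVec_apply, smul_eq_mul, Pi.smul_apply]
    field_simp
    ring
  rw [inv_eq_right_inv h1, trace_sub, trace_smul, trace_vecMulVec, smul_eq_mul]
  congr 2
  rw [← mulVec_mulVec, dotProduct_mulVec v, hX.inv_vecMul_eq]

omit [DecidableEq n] in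
theorem PosDef.dotProduct_pos {X : Matrix n n ℝ} (hX : X.PosDef) {v : n → ℝ} (hv : v ≠ 0) :
    0 < v ⬝ᵥ X *ᵥ v := by simpa using hX.dotProduct_mulVec_pos hv

theorem PosDef.sub_smul_vecMulVec {X : Matrix n n ℝ} (hX : X.PosDef) {v : n → ℝ} {t : ℝ}
    (ht : 0 < t) (htv : t * (v ⬝ᵥ X⁻¹ *ᵥ v) < 1) : (X - t • vecMulVec v v).PosDef := by
  have hu : IsUnit X.det := (isUnit_iff_isUnit_det X).1 hX.isUnit
  refine PosDef.of_dotProduct_mulVec_pos (hX.1.sub ?_) fun x hx => ?_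
  · ext i j; simp [vecMulVec_apply, mul_comm]
  have h0 := hX.dotProduct_pos hx
  set d := v ⬝ᵥ x with hd
  set c := v ⬝ᵥ X⁻¹ *ᵥ v with hc
  -- Cauchy–Schwarz in disguise: this is the form of `X` at `x - (t * d) • X⁻¹ *ᵥ v`.
  have key : 0 ≤ x ⬝ᵥ X *ᵥ x - 2 * t * d ^ 2 + t ^ 2 * d ^ 2 * c := by
    have h := hX.posSemidef.dotProduct_mulVec_nonneg (x - (t * d) • X⁻¹ *ᵥ v)
    have e1 : (X⁻¹ *ᵥ v) ⬝ᵥ (X *ᵥ x) = d := by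
      rw [dotProduct_mulVec, ← hX.inv_vecMul_eq, vecMul_vecMul, Matrix.nonsing_inv_mul _ hu,
        vecMul_one]
    have e2 : X *ᵥ X⁻¹ *ᵥ v = v := by
      rw [mulVec_mulVec, Matrix.mul_nonsing_inv _ hu, one_mulVec]
    have e3 : (X⁻¹ *ᵥ v) ⬝ᵥ v = c := dotProduct_comm _ _
    have e4 : x ⬝ᵥ v = d := dotProduct_comm _ _
    simp only [star_trivial, mulVec_sub, mulVec_smul, dotProduct_sub, sub_dotProduct,
      smul_dotProduct, dotProduct_smul, e1, e2, e3, e4, smul_eq_mul] at h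
    linarith
  have : x ⬝ᵥ (X - t • vecMulVec v v) *ᵥ x = x ⬝ᵥ X *ᵥ x - t * d ^ 2 := by
    rw [sub_mulVec, dotProduct_sub, smul_mulVec, vecMulVec_mulVec, dotProduct_smul,
      op_smul_eq_smul, dotProduct_smul, dotProduct_comm x v, ← hd, smul_eq_mul, smul_eq_mul]
    ring
  rw [star_trivial, this]
  rcases eq_or_ne d 0 with hd0 | hd0
  · simpa [hd0] using h0
  · have : 0 < t * d ^ 2 * (1 - t * c) := by
      have := sub_pos.2 htv
      positivity
    linarith

theorem PosDef.sq_dotProduct_pos {X : Matrix n n ℝ} (hX : X.PosDef) {v : n → ℝ} (hv : v ≠ 0) :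
    0 < v ⬝ᵥ (X⁻¹ * X⁻¹) *ᵥ v := by
  have hu : IsUnit X.det := (isUnit_iff_isUnit_det X).1 hX.isUnit
  rw [← mulVec_mulVec, dotProduct_mulVec v, hX.inv_vecMul_eq]
  have hne : X⁻¹ *ᵥ v ≠ 0 := fun h => hv (by
    have := congrArg (X *ᵥ ·) h
    simpa [mulVec_mulVec, Matrix.mul_nonsing_inv _ hu] using this)
  simpa using dotProduct_star_self_pos_iff.2 hne

/-- By Sherman–Morrison the trace grows by `t * b / (1 - t * c)`; the hypothesis on `1 / t` is the
condition that this is at most `Δ`, solved for `t`. It gives the cost of a step at the upper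
barrier; the next lemma gives the gain at the lower one. -/
theorem PosDef.trace_inv_sub_smul_vecMulVec_le {X : Matrix n n ℝ} (hX : X.PosDef) {v : n → ℝ}
    (hv : v ≠ 0) {t Δ : ℝ} (ht : 0 < t) (hΔ : 0 < Δ)
    (h : (v ⬝ᵥ (X⁻¹ * X⁻¹) *ᵥ v) / Δ + v ⬝ᵥ X⁻¹ *ᵥ v ≤ 1 / t) :
    (X - t • vecMulVec v v).PosDef ∧
      trace (X - t • vecMulVec v v)⁻¹ ≤ trace X⁻¹ + Δ := by
  have hb := hX.sq_dotProduct_pos hv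
  set b := v ⬝ᵥ (X⁻¹ * X⁻¹) *ᵥ v
  set c := v ⬝ᵥ X⁻¹ *ᵥ v with hc
  have hc1 : t * c < 1 := by
    have : c < 1 / t := by have := div_pos hb hΔ; linarith
    rwa [lt_div_iff₀ ht, mul_comm] at this
  refine ⟨hX.sub_smul_vecMulVec ht hc1, ?_⟩
  have e : X - t • vecMulVec v v = X + (-t) • vecMulVec v v := by rw [neg_smul, sub_eq_add_neg]
  have hpos : 0 < 1 + -t * c := by linarith
  rw [e, hX.trace_inv_add_smul_vecMulVec v (-t) hpos.ne', ← hc]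
  have h2 : t * b ≤ Δ * (1 + -t * c) := by
    have := mul_le_mul_of_nonneg_left h (mul_pos ht hΔ).le
    field_simp at this
    linarith
  have h3 : t / (1 + -t * c) * b ≤ Δ := by
    rw [div_mul_eq_mul_div, div_le_iff₀ hpos]; exact h2
  have h4 : -t / (1 + -t * c) * b = -(t / (1 + -t * c) * b) := by ring
  linarith

theorem PosDef.trace_inv_add_smul_vecMulVec_le {X : Matrix n n ℝ} (hX : X.PosDef) {v : n → ℝ}
    (hv : v ≠ 0) {t Δ : ℝ} (ht : 0 < t) (hΔ : 0 < Δ)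
    (h : 1 / t ≤ (v ⬝ᵥ (X⁻¹ * X⁻¹) *ᵥ v) / Δ - v ⬝ᵥ X⁻¹ *ᵥ v) :
    (X + t • vecMulVec v v).PosDef ∧
      trace (X + t • vecMulVec v v)⁻¹ ≤ trace X⁻¹ - Δ := by
  constructor
  · refine hX.add_posSemidef (PosSemidef.smul ?_ ht.le)
    simpa using posSemidef_vecMulVec_self_star v
  have hc0 := hX.inv.dotProduct_pos hv
  set b := v ⬝ᵥ (X⁻¹ * X⁻¹) *ᵥ v
  set c := v ⬝ᵥ X⁻¹ *ᵥ v with hc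
  have hpos : 0 < 1 + t * c := by positivity
  rw [hX.trace_inv_add_smul_vecMulVec v t hpos.ne', ← hc]
  have h2 : Δ * (1 + t * c) ≤ t * b := by
    have := mul_le_mul_of_nonneg_left h (mul_pos ht hΔ).le
    field_simp at this
    linarith
  have h3 : Δ ≤ t / (1 + t * c) * b := by
    rw [div_mul_eq_mul_div, le_div_iff₀ hpos]; exact h2
  linarith

end Matrix

/-! ### Eigenvalue inequalities for moving the barriers -/

/-- Termwise convexity: the graph of `1 / x` lies above its tangent at `μ j + δ`. -/
theorem sum_sq_inv_add_le {n : Type*} [Fintype n] {μ : n → ℝ} (hμ : ∀ j, 0 < μ j) {δ : ℝ}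
    (hδ : 0 < δ) :
    δ * ∑ j, (μ j + δ)⁻¹ ^ 2 ≤ ∑ j, (μ j + 0)⁻¹ - ∑ j, (μ j + δ)⁻¹ := by
  rw [Finset.mul_sum, ← Finset.sum_sub_distrib]
  refine Finset.sum_le_sum fun j _ => ?_
  have h := hμ j
  have h2 : (μ j + 0)⁻¹ - (μ j + δ)⁻¹ - δ * (μ j + δ)⁻¹ ^ 2 =
      δ ^ 2 * (μ j)⁻¹ * (μ j + δ)⁻¹ ^ 2 := by
    rw [add_zero]
    field_simp
    ring
  have : 0 ≤ δ ^ 2 * (μ j)⁻¹ * (μ j + δ)⁻¹ ^ 2 := by positivity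
  linarith

/-- With `D = ∑ 1 / ((ν - 1) ν)` the right side is `D + ∑ 1 / ((ν - 1) ^ 2 ν)`, and Cauchy–Schwarz
with `∑ 1 / ν ≤ 1` bounds the last sum below by `D ^ 2`. -/
theorem le_sum_sq_inv_sub_one {n : Type*} [Fintype n] {ν : n → ℝ} (hν : ∀ j, 1 < ν j)
    (hsum : ∑ j, (ν j + 0)⁻¹ ≤ 1) :
    (1 + (∑ j, (ν j + -1)⁻¹ - ∑ j, (ν j + 0)⁻¹)) * (∑ j, (ν j + -1)⁻¹ - ∑ j, (ν j + 0)⁻¹) ≤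
      ∑ j, (ν j + -1)⁻¹ ^ 2 := by
  simp only [add_zero] at *
  have hp (j) : 0 < ν j + -1 := by linarith [hν j]
  have hq (j) : 0 < ν j := by linarith [hν j]
  have hD : ∑ j, (ν j + -1)⁻¹ - ∑ j, (ν j)⁻¹ = ∑ j, (ν j + -1)⁻¹ * (ν j)⁻¹ := by
    rw [← Finset.sum_sub_distrib]
    refine Finset.sum_congr rfl fun j _ => ?_
    have := (hp j).ne'; have := (hq j).ne'
    field_simp
    ring
  have hE : ∑ j, (ν j + -1)⁻¹ ^ 2 =
      ∑ j, (ν j + -1)⁻¹ * (ν j)⁻¹ + ∑ j, (ν j + -1)⁻¹ ^ 2 * (ν j)⁻¹ := by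
    rw [← Finset.sum_add_distrib]
    refine Finset.sum_congr rfl fun j _ => ?_
    have := (hp j).ne'; have := (hq j).ne'
    field_simp
    ring
  have hCS : (∑ j, (ν j + -1)⁻¹ * (ν j)⁻¹) ^ 2 ≤
      (∑ j, (ν j + -1)⁻¹ ^ 2 * (ν j)⁻¹) * ∑ j, (ν j)⁻¹ := by
    refine Finset.sum_sq_le_sum_mul_sum_of_sq_le_mul _ (fun j _ => ?_) (fun j _ => ?_)
      fun j _ => le_of_eq (by ring)
    · have := hq j; positivity
    · exact (inv_pos.2 (hq j)).le
  have h0 : 0 ≤ ∑ j, (ν j + -1)⁻¹ ^ 2 * (ν j)⁻¹ :=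
    Finset.sum_nonneg fun j _ => by have := hq j; positivity
  rw [hD, hE]
  nlinarith [mul_le_mul_of_nonneg_left hsum h0]

/-! ### The barrier method -/

namespace Matrix

variable {ι n : Type*} [Fintype ι] [Fintype n] [DecidableEq n]

theorem sum_dotProduct_mulVec_of_isotropic {v : ι → n → ℝ} (hv : ∑ i, vecMulVec (v i) (v i) = 1)
    (P : Matrix n n ℝ) : ∑ i, v i ⬝ᵥ P *ᵥ v i = trace P := by
  have h (i : ι) : v i ⬝ᵥ P *ᵥ v i = trace (P * vecMulVec (v i) (v i)) := by
    rw [mul_vecMulVec, trace_vecMulVec, dotProduct_comm]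
  simp_rw [h]
  rw [← trace_sum, ← Finset.mul_sum, hv, Matrix.mul_one]

/-- One step of the barrier method: `M` is the distance to the upper barrier, `N` the distance to
the lower one. -/
theorem exists_barrier_step [Nonempty n] {v : ι → n → ℝ} (hv : ∑ i, vecMulVec (v i) (v i) = 1)
    {M N : Matrix n n ℝ} (hM : M.PosDef) (hN : N.PosDef) {δ a b : ℝ} (hδ : 0 < δ)
    (ha : trace M⁻¹ ≤ a) (hb : trace N⁻¹ ≤ b) (hb1 : b < 1) (hab : 1 / δ + a ≤ 1 - b) :
    ∃ i, ∃ t : ℝ, 0 < t ∧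
      (M + δ • 1 - t • vecMulVec (v i) (v i)).PosDef ∧
      trace (M + δ • 1 - t • vecMulVec (v i) (v i))⁻¹ ≤ a ∧
      (N - 1 + t • vecMulVec (v i) (v i)).PosDef ∧
      trace (N - 1 + t • vecMulVec (v i) (v i))⁻¹ ≤ b := by
  obtain ⟨μ, hμ, hM'⟩ := hM.exists_spectrum
  obtain ⟨ν, hν, hN'⟩ := hN.exists_spectrum
  obtain ⟨-, hM0, -⟩ := hM' 0 (by simpa using hμ)
  obtain ⟨hX, hX1, hX2⟩ := hM' δ (fun j => add_pos (hμ j) hδ)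
  obtain ⟨-, hN0, -⟩ := hN' 0 (by simpa using hν)
  rw [zero_smul, add_zero] at hM0 hN0
  -- A lower trace below `1` leaves room to raise the lower barrier by `1`.
  have hν1 (j : n) : 1 < ν j := by
    have h1 : (ν j)⁻¹ < 1 := by
      refine lt_of_le_of_lt ?_ ((hN0.symm.le.trans hb).trans_lt hb1)
      simp only [add_zero]
      exact Finset.single_le_sum (f := fun j => (ν j)⁻¹) (fun i _ => (inv_pos.2 (hν i)).le)
        (Finset.mem_univ j)
    exact (inv_lt_one₀ (hν j)).1 h1
  obtain ⟨hY, hY1, hY2⟩ := hN' (-1) (fun j => by linarith [hν1 j])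
  have hs1 := sum_sq_inv_add_le hμ hδ
  have hs2 := le_sum_sq_inv_sub_one hν1 (by linarith)
  rw [← hM0, ← hX1, ← hX2] at hs1
  rw [← hN0, ← hY1, ← hY2] at hs2
  have hYe : N + (-1 : ℝ) • 1 = N - 1 := by rw [neg_smul, one_smul, sub_eq_add_neg]
  rw [hYe] at hY hs2 hY1 hY2
  set X := M + δ • (1 : Matrix n n ℝ) with hXdef
  set Y := N - 1 with hYdef
  have hΔ1 : 0 < trace M⁻¹ - trace X⁻¹ := by
    refine lt_of_lt_of_le (mul_pos hδ ?_) hs1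
    rw [hX2]
    exact Finset.sum_pos (fun j _ => by have := hμ j; positivity) Finset.univ_nonempty
  have hΔ2 : 0 < trace Y⁻¹ - trace N⁻¹ := by
    rw [hY1, hN0, ← Finset.sum_sub_distrib]
    refine Finset.sum_pos (fun j _ => ?_) Finset.univ_nonempty
    have := hν1 j
    exact sub_pos.2 (inv_strictAnti₀ (by linarith) (by linarith))
  set Δ₁ := trace M⁻¹ - trace X⁻¹ with hΔ₁
  set Δ₂ := trace Y⁻¹ - trace N⁻¹ with hΔ₂
  let U : ι → ℝ := fun i => (v i ⬝ᵥ (X⁻¹ * X⁻¹) *ᵥ v i) / Δ₁ + v i ⬝ᵥ X⁻¹ *ᵥ v i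
  let L : ι → ℝ := fun i => (v i ⬝ᵥ (Y⁻¹ * Y⁻¹) *ᵥ v i) / Δ₂ - v i ⬝ᵥ Y⁻¹ *ᵥ v i
  have hU : ∑ i, U i ≤ 1 / δ + a := by
    simp only [U]
    rw [Finset.sum_add_distrib, ← Finset.sum_div, sum_dotProduct_mulVec_of_isotropic hv,
      sum_dotProduct_mulVec_of_isotropic hv]
    have : trace (X⁻¹ * X⁻¹) / Δ₁ ≤ 1 / δ := by
      rw [div_le_div_iff₀ hΔ1 hδ]; linarith
    linarith
  have hL : 1 - b ≤ ∑ i, L i := by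
    simp only [L]
    rw [Finset.sum_sub_distrib, ← Finset.sum_div, sum_dotProduct_mulVec_of_isotropic hv,
      sum_dotProduct_mulVec_of_isotropic hv]
    have : 1 + Δ₂ ≤ trace (Y⁻¹ * Y⁻¹) / Δ₂ := by
      rwa [le_div_iff₀ hΔ2]
    linarith
  -- Any `1 / t` between `U i` and `L i` is admissible at both barriers. Zero vectors have `U i = L
  -- i = 0`, so plain averaging could return a useless index; strictness at a nonzero vector
  -- excludes this.
  obtain ⟨i, hi, hUL⟩ : ∃ i, v i ≠ 0 ∧ U i ≤ L i := by
    by_contra! hcon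
    have hle (i : ι) : L i ≤ U i := by
      rcases eq_or_ne (v i) 0 with h | h
      · simp [U, L, h]
      · exact (hcon i h).le
    have hex : ∃ i, v i ≠ 0 := by
      by_contra! h0
      have : (0 : Matrix n n ℝ) = 1 := by rw [← hv]; simp [h0]
      exact zero_ne_one this
    obtain ⟨i, hi⟩ := hex
    have := Finset.sum_lt_sum (s := Finset.univ) (fun i _ => hle i)
      ⟨i, Finset.mem_univ i, hcon i hi⟩
    linarith
  have hUpos : 0 < U i :=
    add_pos (div_pos (hX.sq_dotProduct_pos hi) hΔ1) (hX.inv.dotProduct_pos hi)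
  have hLpos : 0 < L i := hUpos.trans_le hUL
  obtain ⟨r1, r2⟩ := hX.trace_inv_sub_smul_vecMulVec_le hi (one_div_pos.2 hLpos) hΔ1
    (by rw [one_div_one_div]; exact hUL)
  obtain ⟨r3, r4⟩ := hY.trace_inv_add_smul_vecMulVec_le hi (one_div_pos.2 hLpos) hΔ2
    (by rw [one_div_one_div])
  exact ⟨i, 1 / L i, one_div_pos.2 hLpos, r1, by linarith, r3, by linarith⟩

/-- The barrier method run for `q` steps. -/
theorem exists_barrier_weights [Nonempty n] [DecidableEq ι] {v : ι → n → ℝ}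
    (hv : ∑ i, vecMulVec (v i) (v i) = 1) {δ a b u l : ℝ} (hδ : 0 < δ) (hu : 0 < u) (hl : 0 < l)
    (ha : (Fintype.card n : ℝ) / u ≤ a) (hb : (Fintype.card n : ℝ) / l ≤ b) (hb1 : b < 1)
    (hab : 1 / δ + a ≤ 1 - b) (q : ℕ) :
    ∃ s : ι → ℝ, (∀ i, 0 ≤ s i) ∧ (Finset.univ.filter (fun i => s i ≠ 0)).card ≤ q ∧
      ((u + q * δ) • 1 - ∑ i, s i • vecMulVec (v i) (v i)).PosDef ∧
      trace ((u + q * δ) • 1 - ∑ i, s i • vecMulVec (v i) (v i))⁻¹ ≤ a ∧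
      (∑ i, s i • vecMulVec (v i) (v i) - (q - l) • 1).PosDef ∧
      trace (∑ i, s i • vecMulVec (v i) (v i) - (q - l) • (1 : Matrix n n ℝ))⁻¹ ≤ b := by
  have hscal {c : ℝ} (hc : 0 < c) : trace (c • (1 : Matrix n n ℝ))⁻¹ = Fintype.card n / c := by
    have : (c • (1 : Matrix n n ℝ))⁻¹ = c⁻¹ • 1 := inv_eq_right_inv (by
      rw [Matrix.smul_mul, Matrix.one_mul, smul_smul, mul_inv_cancel₀ hc.ne', one_smul])
    rw [this, trace_smul, trace_one, smul_eq_mul]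
    field_simp
  induction q with
  | zero =>
    refine ⟨fun _ => 0, fun _ => le_rfl, by simp, ?_⟩
    simp only [zero_smul, Finset.sum_const_zero, Nat.cast_zero, zero_mul, add_zero, sub_zero,
      zero_sub, neg_smul, neg_neg, hscal hu, hscal hl]
    exact ⟨PosDef.one.smul hu, ha, PosDef.one.smul hl, hb⟩
  | succ q ih =>
    obtain ⟨s, hs, hcard, hM, hMa, hN, hNb⟩ := ih
    obtain ⟨i, t, ht, r1, r2, r3, r4⟩ := exists_barrier_step hv hM hN hδ hMa hNb hb1 hab
    have hsum : ∑ j, (s j + if j = i then t else 0) • vecMulVec (v j) (v j) =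
        ∑ j, s j • vecMulVec (v j) (v j) + t • vecMulVec (v i) (v i) := by
      simp only [add_smul, Finset.sum_add_distrib, ite_smul, zero_smul, Finset.sum_ite_eq',
        Finset.mem_univ, if_true]
    have e1 : (u + (q + 1 : ℕ) * δ) • (1 : Matrix n n ℝ) -
        (∑ j, s j • vecMulVec (v j) (v j) + t • vecMulVec (v i) (v i)) =
        (u + q * δ) • 1 - ∑ j, s j • vecMulVec (v j) (v j) + δ • 1 -
          t • vecMulVec (v i) (v i) := by
      push_cast
      module
    have e2 : (∑ j, s j • vecMulVec (v j) (v j) + t • vecMulVec (v i) (v i)) -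
        ((q + 1 : ℕ) - l) • (1 : Matrix n n ℝ) =
        ∑ j, s j • vecMulVec (v j) (v j) - (q - l) • 1 - 1 + t • vecMulVec (v i) (v i) := by
      push_cast
      module
    refine ⟨fun j => s j + if j = i then t else 0, fun j => ?_, ?_, ?_⟩
    · have := hs j
      dsimp only
      split_ifs <;> positivity
    · refine (Finset.card_le_card ?_).trans ((Finset.card_insert_le i _).trans
        (Nat.add_le_add_right hcard 1))
      intro j hj
      by_cases h : j = i
      · simp [h]
      · simpa [h] using hj
    · rw [hsum, e1, e2]
      exact ⟨r1, r2, r3, r4⟩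

end Matrix

/-! ### Sparsifying quadratic forms -/

/-- Sparsification of isotropic families of vectors. -/
theorem exists_isotropic_sparsifier {ι n : Type*} [Fintype ι] [Fintype n] [DecidableEq n]
    [DecidableEq ι] {v : ι → n → ℝ} (hv : ∑ i, vecMulVec (v i) (v i) = 1) {ε : ℝ} (hε : 0 < ε)
    (hε1 : ε < 1) :
    ∃ s : ι → ℝ, (∀ i, 0 ≤ s i) ∧
      ((Finset.univ.filter (fun i => s i ≠ 0)).card : ℝ) ≤ 65 * Fintype.card n / ε ^ 2 ∧
      ∀ x : n → ℝ, (1 - ε) * (x ⬝ᵥ x) ≤ ∑ i, s i * (v i ⬝ᵥ x) ^ 2 ∧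
        ∑ i, s i * (v i ⬝ᵥ x) ^ 2 ≤ (1 + ε) * (x ⬝ᵥ x) := by
  rcases isEmpty_or_nonempty n with hn | hn
  · exact ⟨fun _ => 0, fun _ => le_rfl, by simp, fun x => by simp [dotProduct]⟩
  set d : ℝ := (Fintype.card n : ℝ) with hd
  have hd1 : 1 ≤ d := by
    rw [hd]; exact_mod_cast Fintype.card_pos
  have hd0 : 0 < d := by linarith
  -- The factor `8` ensures `(1 + η) ^ 2 / (1 - η) ≤ 1 + ε`; `δ` below makes `1 / δ + η / δ = 1 -
  -- η`, the barrier condition with equality.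
  set η := ε / 8 with hη
  have hη0 : 0 < η := by positivity
  have hη1 : η < 1 / 8 := by linarith
  have hη2 : 0 < 1 - η := by linarith
  set δ := (1 + η) / (1 - η) with hδ
  have hδ0 : 0 < δ := by positivity
  set q := ⌈d / η ^ 2⌉₊ with hq
  have hq1 : d / η ^ 2 ≤ q := Nat.le_ceil _
  have hq2 : (q : ℝ) ≤ d / η ^ 2 + 1 := (Nat.ceil_lt_add_one (by positivity)).le
  have hq0 : (0 : ℝ) < q := lt_of_lt_of_le (by positivity) hq1
  have hdq : d / η ≤ η * q := by
    rw [div_le_iff₀ (by positivity)] at hq1 ⊢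
    linarith
  obtain ⟨s, hs, hcard, hM, -, hN, -⟩ := exists_barrier_weights (δ := δ) (a := η / δ) (b := η)
    (u := d * δ / η) (l := d / η) hv hδ0 (by positivity) (by positivity)
    (le_of_eq (by rw [← hd]; field_simp)) (le_of_eq (by rw [← hd]; field_simp)) (by linarith)
    (le_of_eq (by rw [hδ]; field_simp)) q
  have hform (x : n → ℝ) : x ⬝ᵥ (∑ i, s i • vecMulVec (v i) (v i)) *ᵥ x =
      ∑ i, s i * (v i ⬝ᵥ x) ^ 2 := by
    rw [sum_mulVec, dotProduct_sum]
    refine Finset.sum_congr rfl fun i _ => ?_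
    rw [smul_mulVec, vecMulVec_mulVec, op_smul_eq_smul, dotProduct_smul, dotProduct_smul,
      dotProduct_comm x, smul_eq_mul, smul_eq_mul, sq]
  have hone (c : ℝ) (x : n → ℝ) : x ⬝ᵥ (c • (1 : Matrix n n ℝ)) *ᵥ x = c * (x ⬝ᵥ x) := by
    rw [smul_mulVec, one_mulVec, dotProduct_smul, smul_eq_mul]
  refine ⟨fun i => s i / q, fun i => div_nonneg (hs i) hq0.le, ?_, fun x => ?_⟩
  · have : (Finset.univ.filter (fun i => s i / q ≠ 0)) = Finset.univ.filter (fun i => s i ≠ 0) := by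
      ext i; simp [hq0.ne']
    rw [this]
    -- Absorbs the rounding in `q`, whence `65 = 8 ^ 2 + 1`.
    have h1 : (1 : ℝ) ≤ d / ε ^ 2 := by
      rw [le_div_iff₀ (by positivity)]
      nlinarith
    calc ((Finset.univ.filter (fun i => s i ≠ 0)).card : ℝ) ≤ q := by exact_mod_cast hcard
      _ ≤ d / η ^ 2 + 1 := hq2
      _ ≤ d / η ^ 2 + d / ε ^ 2 := by linarith
      _ = 65 * d / ε ^ 2 := by rw [hη]; field_simp; ring
  · have hx : 0 ≤ x ⬝ᵥ x := by simpa using dotProduct_star_self_nonneg x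
    have hU := hM.posSemidef.dotProduct_mulVec_nonneg x
    have hL := hN.posSemidef.dotProduct_mulVec_nonneg x
    rw [star_trivial, sub_mulVec, dotProduct_sub, hform, hone] at hU hL
    have hdiv : ∑ i, s i / q * (v i ⬝ᵥ x) ^ 2 = (∑ i, s i * (v i ⬝ᵥ x) ^ 2) / q := by
      rw [Finset.sum_div]
      exact Finset.sum_congr rfl fun i _ => by ring
    rw [hdiv, le_div_iff₀ hq0, div_le_iff₀ hq0]
    constructor
    · have : (1 - ε) * q ≤ q - d / η := by nlinarith
      nlinarith [mul_le_mul_of_nonneg_right this hx]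
    · have h1 : δ * (1 + η) ≤ 1 + ε := by
        rw [hδ, div_mul_eq_mul_div, div_le_iff₀ hη2]
        have : ε = 8 * η := by rw [hη]; ring
        rw [this]; nlinarith
      have h2 : d * δ / η + q * δ ≤ (1 + ε) * q := by
        calc d * δ / η + q * δ = δ * (d / η + q) := by ring
          _ ≤ δ * (η * q + q) := by gcongr
          _ = δ * (1 + η) * q := by ring
          _ ≤ _ := by gcongr
      nlinarith [mul_le_mul_of_nonneg_right h2 hx]

/-- Sparsification of sums of squares of linear functionals. -/
theorem exists_sum_sq_sparsifier {ι E : Type*} [Fintype ι] [AddCommGroup E] [Module ℝ E]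
    [FiniteDimensional ℝ E] (φ : ι → E →ₗ[ℝ] ℝ) {ε : ℝ} (hε : 0 < ε) (hε1 : ε < 1) :
    ∃ s : ι → ℝ, (∀ i, 0 ≤ s i) ∧
      ({i | s i ≠ 0}.ncard : ℝ) ≤ 65 * Module.finrank ℝ E / ε ^ 2 ∧
      ∀ x : E, (1 - ε) * ∑ i, φ i x ^ 2 ≤ ∑ i, s i * φ i x ^ 2 ∧
        ∑ i, s i * φ i x ^ 2 ≤ (1 + ε) * ∑ i, φ i x ^ 2 := by
  classical
  let T : E →ₗ[ℝ] EuclideanSpace ℝ ι :=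
    (WithLp.linearEquiv 2 ℝ (ι → ℝ)).symm.toLinearMap ∘ₗ LinearMap.pi φ
  have hT (x : E) (i : ι) : T x i = φ i x := rfl
  let b := stdOrthonormalBasis ℝ (LinearMap.range T)
  -- Rows of an orthonormal basis of the range of `T`: orthonormality of the columns is isotropy of
  -- the rows, and the form may be degenerate.
  let v : ι → Fin (Module.finrank ℝ (LinearMap.range T)) → ℝ :=
    fun i j => (b j : EuclideanSpace ℝ ι) i
  have hv : ∑ i, vecMulVec (v i) (v i) = 1 := by
    ext j k
    rw [Matrix.sum_apply, Matrix.one_apply, ← orthonormal_iff_ite.1 b.orthonormal j k,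
      Submodule.coe_inner, PiLp.inner_apply]
    refine Finset.sum_congr rfl fun i _ => ?_
    simp [vecMulVec_apply, v, mul_comm]
  obtain ⟨s, hs, hcard, h⟩ := exists_isotropic_sparsifier hv hε hε1
  refine ⟨s, hs, ?_, fun x => ?_⟩
  · have e : {i | s i ≠ 0} = ↑(Finset.univ.filter (fun i => s i ≠ 0)) := by ext; simp
    rw [e, Set.ncard_coe_finset]
    refine hcard.trans ?_
    rw [Fintype.card_fin]
    have := LinearMap.finrank_range_le T
    gcongr
  · let y : LinearMap.range T := ⟨T x, LinearMap.mem_range_self T x⟩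
    let c : Fin (Module.finrank ℝ (LinearMap.range T)) → ℝ := fun j => b.repr y j
    have hφ (i : ι) : v i ⬝ᵥ c = φ i x := by
      let L : LinearMap.range T →ₗ[ℝ] ℝ :=
        (EuclideanSpace.proj i : EuclideanSpace ℝ ι →L[ℝ] ℝ).toLinearMap ∘ₗ
          (LinearMap.range T).subtype
      have h1 : L (∑ j, b.repr y j • b j) = L y := by rw [b.sum_repr]
      rw [map_sum] at h1
      simp only [map_smul, smul_eq_mul] at h1
      rw [dotProduct_comm]
      exact h1
    have hcc : c ⬝ᵥ c = ∑ i, φ i x ^ 2 := by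
      have h1 : c ⬝ᵥ (∑ i, vecMulVec (v i) (v i)) *ᵥ c = c ⬝ᵥ c := by rw [hv, one_mulVec]
      rw [← h1, sum_mulVec, dotProduct_sum]
      refine Finset.sum_congr rfl fun i _ => ?_
      rw [vecMulVec_mulVec, op_smul_eq_smul, dotProduct_smul, dotProduct_comm c, hφ, smul_eq_mul,
        sq]
    have := h c
    simpa only [hφ, hcc] using this

/-! ### From quadratic forms to digraphs -/

namespace WeightedDigraph

variable {V : Type*}

/-- Predicates of the form `(a x - b y)²` are values of the quadratic form of the bipartite double
cover. -/
theorem predValue_eq_of_sq (G : WeightedDigraph V) {P : BoolPred} {a b : Bool → ℝ}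
    (h : ∀ p q, ((P p q).toNat : ℝ) = (a p - b q) ^ 2) (S : Set V) :
    G.predValue P S = ∑ e ∈ G.edges, G.weight e * (a (indic S e.1) - b (indic S e.2)) ^ 2 :=
  Finset.sum_congr rfl fun e _ => by rw [h, mul_comm]

/-- Being a sparsifier passes to half of the sum of three predicates. -/
theorem IsSparsifier.half_sum {H G : WeightedDigraph V} {ε : ℝ} {P P₁ P₂ P₃ : BoolPred}
    (h₁ : IsSparsifier ε P₁ H G) (h₂ : IsSparsifier ε P₂ H G) (h₃ : IsSparsifier ε P₃ H G)
    (h : ∀ p q, 2 * ((P p q).toNat : ℝ) =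
      (P₁ p q).toNat + (P₂ p q).toNat + (P₃ p q).toNat) :
    IsSparsifier ε P H G := by
  have hval (K : WeightedDigraph V) (S : Set V) :
      K.predValue P S = (K.predValue P₁ S + K.predValue P₂ S + K.predValue P₃ S) / 2 := by
    rw [eq_div_iff two_ne_zero, mul_comm]
    simp only [predValue, Finset.mul_sum, ← Finset.sum_add_distrib]
    exact Finset.sum_congr rfl fun e _ => by rw [← mul_assoc, h]; ring
  refine ⟨h₁.1, fun S => ?_⟩
  obtain ⟨l₁, u₁⟩ := h₁.2 S
  obtain ⟨l₂, u₂⟩ := h₂.2 S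
  obtain ⟨l₃, u₃⟩ := h₃.2 S
  rw [hval G, hval H]
  constructor <;> linarith

/-- A sparsifier of the double cover, for all differences of vertex potentials. -/
theorem exists_doubleCover_sparsifier [Fintype V] (G : WeightedDigraph V) {ε : ℝ} (hε : 0 < ε)
    (hε1 : ε < 1) :
    ∃ H : WeightedDigraph V, H.IsSubdigraph G ∧
      (H.edges.card : ℝ) ≤ 130 * Fintype.card V / ε ^ 2 ∧
      ∀ x y : V → ℝ,
        (1 - ε) * ∑ e ∈ G.edges, G.weight e * (x e.1 - y e.2) ^ 2 ≤
          ∑ e ∈ H.edges, H.weight e * (x e.1 - y e.2) ^ 2 ∧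
        ∑ e ∈ H.edges, H.weight e * (x e.1 - y e.2) ^ 2 ≤
          (1 + ε) * ∑ e ∈ G.edges, G.weight e * (x e.1 - y e.2) ^ 2 := by
  classical
  -- Each vertex has separate tail and head coordinates; the dimension `2 * |V|` turns `65` into
  -- `130`.
  let φ : G.edges → (V ⊕ V → ℝ) →ₗ[ℝ] ℝ := fun e =>
    Real.sqrt (G.weight e) •
      (LinearMap.proj (R := ℝ) (φ := fun _ : V ⊕ V => ℝ) (Sum.inl e.1.1) -
        LinearMap.proj (R := ℝ) (φ := fun _ : V ⊕ V => ℝ) (Sum.inr e.1.2))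
  have hφ (e : G.edges) (x y : V → ℝ) :
      φ e (Sum.elim x y) ^ 2 = G.weight e * (x e.1.1 - y e.1.2) ^ 2 := by
    simp [φ, mul_pow, Real.sq_sqrt (G.weight_nonneg e e.2)]
  obtain ⟨s, hs, hcard, h⟩ := exists_sum_sq_sparsifier φ hε hε1
  let s' : V × V → ℝ := fun e => if he : e ∈ G.edges then s ⟨e, he⟩ else 0
  have hs' (e : G.edges) : s' e = s e := by simp [s']
  let H : WeightedDigraph V :=
    { edges := G.edges.filter (fun e => s' e ≠ 0)
      weight := fun e => s' e * G.weight e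
      weight_nonneg := fun e he => by
        have he' := (Finset.mem_filter.1 he).1
        exact mul_nonneg (by rw [hs' ⟨e, he'⟩]; exact hs _) (G.weight_nonneg e he') }
  refine ⟨H, Finset.filter_subset _ _, ?_, fun x y => ?_⟩
  · have e1 : H.edges.card = {e | s e ≠ 0}.ncard := by
      rw [← Set.ncard_image_of_injective _ Subtype.val_injective, ← Set.ncard_coe_finset]
      congr 1
      ext e
      simp only [H, s', Finset.coe_filter, Set.mem_ofPred_eq, Set.mem_image, Subtype.exists,
        exists_and_right, exists_eq_right]
      constructor
      · rintro ⟨he, h⟩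
        exact ⟨he, by simpa [he] using h⟩
      · rintro ⟨he, h⟩
        exact ⟨he, by simpa [he] using h⟩
    rw [e1]
    refine hcard.trans (le_of_eq ?_)
    rw [Module.finrank_fintype_fun_eq_card, Fintype.card_sum]
    push_cast
    ring
  · have hG : ∑ e ∈ G.edges, G.weight e * (x e.1 - y e.2) ^ 2 =
        ∑ e, φ e (Sum.elim x y) ^ 2 := by
      simp only [hφ]
      exact (Finset.sum_coe_sort G.edges fun e => G.weight e * (x e.1 - y e.2) ^ 2).symm
    have hH : ∑ e ∈ H.edges, H.weight e * (x e.1 - y e.2) ^ 2 =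
        ∑ e, s e * φ e (Sum.elim x y) ^ 2 := by
      simp only [hφ, ← hs']
      rw [Finset.sum_coe_sort G.edges fun e => s' e * (G.weight e * (x e.1 - y e.2) ^ 2)]
      simp only [H, mul_assoc]
      refine Finset.sum_filter_of_ne fun e _ hne h0 => hne ?_
      rw [h0, zero_mul]
    rw [hG, hH]
    exact h _

end WeightedDigraph

theorem mainTheorem2 :
    ∃ C : ℝ, 0 < C ∧
      ∀ (V : Type*) [Fintype V] (G : WeightedDigraph V) (ε : ℝ), 0 < ε → ε < 1 →
        ∃ H : WeightedDigraph V,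
          H.IsSubdigraph G ∧
          (H.edges.card : ℝ) ≤ C * (Fintype.card V : ℝ) / ε ^ 2 ∧
          ∀ P ∈ ({BoolPred.Cut, BoolPred.unCut, BoolPred.Or, BoolPred.nAnd,
              BoolPred.not10, BoolPred.not01, BoolPred.x0, BoolPred.x1,
              BoolPred.zerox, BoolPred.onex, BoolPred.allOne, BoolPred.allZero} : Set BoolPred),
            WeightedDigraph.IsSparsifier ε P H G := by
  refine ⟨130, by norm_num, fun V _ G ε hε hε1 => ?_⟩
  obtain ⟨H, hsub, hcard, hH⟩ := G.exists_doubleCover_sparsifier hε hε1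
  refine ⟨H, hsub, hcard, ?_⟩
  have hsq {P : BoolPred} (a b : Bool → ℝ) (h : ∀ p q, ((P p q).toNat : ℝ) = (a p - b q) ^ 2) :
      WeightedDigraph.IsSparsifier ε P H G := by
    refine ⟨hsub, fun S => ?_⟩
    rw [G.predValue_eq_of_sq h, H.predValue_eq_of_sq h]
    exact hH (fun v => a (WeightedDigraph.indic S v)) fun v => b (WeightedDigraph.indic S v)
  -- Different functions at tail and head reach beyond `Cut`: for instance `unCut` is `(x - (1 - y))
  -- ^ 2`.
  let χ : Bool → ℝ := fun p => p.toNat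
  let χ' : Bool → ℝ := fun p => (!p).toNat
  have hCut : WeightedDigraph.IsSparsifier ε BoolPred.Cut H G :=
    hsq χ χ (by simp [BoolPred.Cut, χ])
  have hunCut : WeightedDigraph.IsSparsifier ε BoolPred.unCut H G :=
    hsq χ χ' (by simp [BoolPred.unCut, χ, χ'])
  have hx0 : WeightedDigraph.IsSparsifier ε BoolPred.x0 H G :=
    hsq 0 χ' (by simp [BoolPred.x0, χ'])
  have hx1 : WeightedDigraph.IsSparsifier ε BoolPred.x1 H G :=
    hsq 0 χ (by simp [BoolPred.x1, χ])
  have hzerox : WeightedDigraph.IsSparsifier ε BoolPred.zerox H G :=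
    hsq χ' 0 (by simp [BoolPred.zerox, χ'])
  have honex : WeightedDigraph.IsSparsifier ε BoolPred.onex H G :=
    hsq χ 0 (by simp [BoolPred.onex, χ])
  have hallOne : WeightedDigraph.IsSparsifier ε BoolPred.allOne H G :=
    hsq 1 0 (by simp [BoolPred.allOne])
  have hallZero : WeightedDigraph.IsSparsifier ε BoolPred.allZero H G :=
    hsq 0 0 (by simp [BoolPred.allZero])
  rintro P (rfl | rfl | rfl | rfl | rfl | rfl | rfl | rfl | rfl | rfl | rfl | rfl)
  · exact hCut
  · exact hunCut
  -- `2 Or = Cut + x1 + 1x`; negating one or both inputs gives the next three cases.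
  · exact hCut.half_sum hx1 honex (by
      simp [BoolPred.Cut, BoolPred.Or, BoolPred.x1, BoolPred.onex]
      norm_num)
  · exact hCut.half_sum hx0 hzerox (by
      simp [BoolPred.Cut, BoolPred.nAnd, BoolPred.x0, BoolPred.zerox]
      norm_num)
  · exact hunCut.half_sum hx1 hzerox (by
      simp [BoolPred.unCut, BoolPred.not10, BoolPred.x1, BoolPred.zerox]
      norm_num)
  · exact hunCut.half_sum hx0 honex (by
      simp [BoolPred.unCut, BoolPred.not01, BoolPred.x0, BoolPred.onex]
      norm_num)
  · exact hx0
  · exact hx1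
  · exact hzerox
  · exact honex
  · exact hallOne
  · exact hallZero
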